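/- Consider the square lattice $\mathbb Z^2$, whose links are the unordered pairs $\{n,n'\}$ of sites with $|n-n'|=1$. Let $(C_e)$ be a family of nonnegative, independent and identically distributed random variables (conductances), one for each link $e$, on a probability space $(\Omega,\mathcal F,\mathbf P)$, with finite mean $\mathbf E(C_e)<\infty$. For $L,A\in\mathbb N$ let $\Lambda(L,A)=\{0,1,\dots,L\}\times\{0,1,\dots,A-1\}$ ($L$ links in the longitudinal direction, $A$ sites in the transverse direction), and let $\partial\Lambda$ be the set of sites of $\Lambda=\Lambda(L,A)$ with a nearest neighbour outside $\Lambda$. Let $v_0>0$. Under closed boundary conditions the potential field $V$ on $\Lambda$ satisfies $V_n=n_1v_0$ for $n=(n_1,n_2)\in\partial\Lambda$ and Kirchhoff's law $$\sum_{n'\in\Lambda:\ |n'-n|=1}(V_n-V_{n'})\,C_{nn'}=0,\qquad n\in\Lambda\setminus\partial\Lambda ,$$ and the dissipation is $W^{\mathrm{CBC}}_{LA}=\sum_{\{n,n'\}\subset\Lambda,\ |n-n'|=1}(V_n-V_{n'})^2C_{nn'}$, each link being counted once. (Such a $V$ exists, and $W^{\mathrm{CBC}}_{LA}$ does not depend on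 its choice.) Then all the $W^{\mathrm{CBC}}_{LA}$ are integrable, and there is a finite constant $\bar c^{\mathrm{CBC}}$, not depending on $v_0$, such that for every $v_0>0$ $$\lim_{L,A\to\infty}\frac{\mathbf E(W^{\mathrm{CBC}}_{LA})}{LA}=v_0^2\,\bar c^{\mathrm{CBC}},$$ both as a double limit and as an iterated limit in either order, and such that, almost surely, the dissipation density $W^{\mathrm{CBC}}_{LA}/(LA)$ has this same limit, independently of the order of the limits on $L$ and $A$: almost surely, the inner and outer limits in $$\lim_{A\to\infty}\lim_{L\to\infty}\frac{W^{\mathrm{CBC}}_{LA}}{LA}=v_0^2\,\bar c^{\mathrm{CBC}},\qquad \lim_{L\to\infty}\lim_{A\to\infty}\frac{W^{\mathrm{CBC}}_{LA}}{LA}=v_0^2\,\bar c^{\mathrm{CBC}}$$ all exist and are finite. -/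

import Mathlib

open MeasureTheory ProbabilityTheory Filter Topology

namespace ResistorNetwork

/-- The sites of the square lattice. The first coordinate is the longitudinal direction (along
which the potential difference is applied), the second one is the transverse direction. -/
abbrev Site : Type := ℤ × ℤ

/-- The square lattice: two sites are joined by a link when they are at distance one. -/
def lattice : SimpleGraph Site where
  Adj n m := |n.1 - m.1| + |n.2 - m.2| = 1
  symm := ⟨fun n m h => by
    rw [abs_sub_comm m.1 n.1, abs_sub_comm m.2 n.2]; exact h⟩
  loopless := ⟨fun n h => by simp at h⟩

instance : DecidableRel lattice.Adj := fun n m =>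
  inferInstanceAs (Decidable (|n.1 - m.1| + |n.2 - m.2| = 1))

/-- The set of (unoriented) links contained in a finite region; every link occurs once. -/
def links (Λ : Finset Site) : Finset (Sym2 Site) :=
  Λ.sym2.filter (fun e => e ∈ lattice.edgeSet)

/-- The boundary of a region: its sites having a nearest neighbour outside the region. -/
def boundary (Λ : Finset Site) : Set Site :=
  {n | n ∈ Λ ∧ ∃ m, m ∉ Λ ∧ lattice.Adj n m}

/-- The squared potential drop across an unoriented link. -/
def sqDrop (φ : Site → ℝ) : Sym2 Site → ℝ :=
  Sym2.lift ⟨fun n m => (φ n - φ m) ^ 2, fun n m => by ring⟩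

/-- The dissipation functional: the power dissipated by Joule effect in the region `Λ`, for the
conductances `c` and the potential field `φ`. -/
def dissipationFunctional (Λ : Finset Site) (c : Sym2 Site → ℝ) (φ : Site → ℝ) : ℝ :=
  ∑ e ∈ links Λ, sqDrop φ e * c e

/-- `V` is a potential field of the network on `Λ` with conductances `c`, whose potential is held
at the values `Vbar` on the set `S`: it has the prescribed values on `S`, and the total current
out of each other site of `Λ` vanishes. Values of `V` outside `Λ` and `S` play no role. -/
structure IsPotential (Λ : Finset Site) (S : Set Site) (c : Sym2 Site → ℝ)
    (Vbar V : Site → ℝ) : Prop where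
  fixed : ∀ n ∈ S, V n = Vbar n
  kirchhoff : ∀ n ∈ Λ, n ∉ S →
    ∑ m ∈ Λ.filter (fun m => lattice.Adj n m), (V n - V m) * c s(n, m) = 0

/-- The power dissipated in the network by the potential field which Kirchhoff's law determines.
For nonnegative conductances and `S ⊆ Λ` such a field exists (`exists_isPotential`) and any two
of them dissipate the same power (`dissipation_eq`). -/
noncomputable def dissipation (Λ : Finset Site) (S : Set Site) (c : Sym2 Site → ℝ)
    (Vbar : Site → ℝ) : ℝ :=
  dissipationFunctional Λ c (Classical.epsilon (IsPotential Λ S c Vbar))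

/-- The rectangle with `L` links (`L + 1` sites) in the longitudinal direction and `A` sites in
the transverse direction. -/
noncomputable def rectangle (L A : ℕ) : Finset Site :=
  Finset.Icc (0 : ℤ) (L : ℤ) ×ˢ Finset.Ico (0 : ℤ) (A : ℤ)

/-- The dissipation of the rectangle under closed boundary conditions: the potential is
`n₁ v₀` at every boundary site `n = (n₁, n₂)`. -/
noncomputable def closedDissipation (v₀ : ℝ) (L A : ℕ) (c : Sym2 Site → ℝ) : ℝ :=
  dissipation (rectangle L A) (boundary (rectangle L A)) c (fun n => (n.1 : ℝ) * v₀)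

/-- The iterated limits of the double sequence `f L A`, in both orders, exist and equal `c`
(terms with a vanishing index are disregarded). -/
def HasIteratedLimits (f : ℕ → ℕ → ℝ) (c : ℝ) : Prop :=
  (∃ g : ℕ → ℝ, (∀ A, 0 < A → Tendsto (fun L => f L A) atTop (𝓝 (g A))) ∧
    Tendsto g atTop (𝓝 c)) ∧
  (∃ h : ℕ → ℝ, (∀ L, 0 < L → Tendsto (fun A => f L A) atTop (𝓝 (h L))) ∧
    Tendsto h atTop (𝓝 c))

/-! ### The potential field exists and its dissipation is well defined -/

theorem two_mul_sum_links (Λ : Finset Site) (f : Sym2 Site → ℝ) :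
    2 * ∑ e ∈ links Λ, f e =
      ∑ n ∈ Λ, ∑ m ∈ Λ.filter (fun m => lattice.Adj n m), f s(n, m) := by
  classical
  set D := (Λ ×ˢ Λ).filter (fun p : Site × Site => lattice.Adj p.1 p.2) with hD
  have h1 : ∑ n ∈ Λ, ∑ m ∈ Λ.filter (fun m => lattice.Adj n m), f s(n, m) =
      ∑ p ∈ D, f s(p.1, p.2) := by
    rw [hD, Finset.sum_filter, Finset.sum_product]
    exact Finset.sum_congr rfl fun n _ => by rw [Finset.sum_filter]
  have hmaps : ∀ p ∈ D, s(p.1, p.2) ∈ links Λ := by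
    intro p hp
    simp only [hD, Finset.mem_filter, Finset.mem_product] at hp
    simp [links, hp.1.1, hp.1.2, hp.2]
  rw [h1, ← Finset.sum_fiberwise_of_maps_to hmaps, Finset.mul_sum]
  refine Finset.sum_congr rfl fun e he => ?_
  induction e using Sym2.ind with
  | _ a b =>
    have he' : (a ∈ Λ ∧ b ∈ Λ) ∧ lattice.Adj a b := by
      simpa [links] using he
    have hab : a ≠ b := he'.2.ne
    have hfib : D.filter (fun p => s(p.1, p.2) = s(a, b)) = {(a, b), (b, a)} := by
      ext ⟨x, y⟩
      simp only [hD, Finset.mem_filter, Finset.mem_product, Sym2.eq_iff, Finset.mem_insert,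
        Finset.mem_singleton, Prod.mk.injEq]
      constructor
      · exact fun h => h.2
      · rintro (⟨rfl, rfl⟩ | ⟨rfl, rfl⟩)
        · exact ⟨he', Or.inl ⟨rfl, rfl⟩⟩
        · exact ⟨⟨he'.1.symm, he'.2.symm⟩, Or.inr ⟨rfl, rfl⟩⟩
    rw [hfib, Finset.sum_pair (by simp [hab])]
    simp only [Sym2.eq_swap (a := b) (b := a)]
    ring

/-- Product of the potential drops of two fields across a link. -/
def dropMul (φ ψ : Site → ℝ) : Sym2 Site → ℝ :=
  Sym2.lift ⟨fun n m => (φ n - φ m) * (ψ n - ψ m), fun n m => by ring⟩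

theorem sum_links_dropMul (Λ : Finset Site) (c : Sym2 Site → ℝ) (φ z : Site → ℝ) :
    ∑ e ∈ links Λ, dropMul φ z e * c e =
      ∑ n ∈ Λ, (∑ m ∈ Λ.filter (fun m => lattice.Adj n m), (φ n - φ m) * c s(n, m)) * z n := by
  have h := two_mul_sum_links Λ (fun e => dropMul φ z e * c e)
  have hsplit : ∑ n ∈ Λ, ∑ m ∈ Λ.filter (fun m => lattice.Adj n m),
        dropMul φ z s(n, m) * c s(n, m) =
      (∑ n ∈ Λ, ∑ m ∈ Λ.filter (fun m => lattice.Adj n m), (φ n - φ m) * c s(n, m) * z n) +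
      ∑ n ∈ Λ, ∑ m ∈ Λ.filter (fun m => lattice.Adj n m), (φ m - φ n) * c s(n, m) * z m := by
    rw [← Finset.sum_add_distrib]
    refine Finset.sum_congr rfl fun n _ => ?_
    rw [← Finset.sum_add_distrib]
    refine Finset.sum_congr rfl fun m _ => ?_
    simp only [dropMul, Sym2.lift_mk]
    ring
  have hswap : ∑ n ∈ Λ, ∑ m ∈ Λ.filter (fun m => lattice.Adj n m),
        (φ m - φ n) * c s(n, m) * z m =
      ∑ n ∈ Λ, ∑ m ∈ Λ.filter (fun m => lattice.Adj n m), (φ n - φ m) * c s(n, m) * z n := by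
    simp only [Finset.sum_filter]
    rw [Finset.sum_comm]
    refine Finset.sum_congr rfl fun n _ => Finset.sum_congr rfl fun m _ => ?_
    simp only [lattice.adj_comm m n, Sym2.eq_swap (a := m) (b := n)]
  rw [hsplit, hswap] at h
  simp only [Finset.sum_mul]
  linarith

/-- For nonnegative conductances, Kirchhoff's law has a solution. -/
theorem exists_isPotential (Λ : Finset Site) (S : Set Site) (c : Sym2 Site → ℝ)
    (hc : ∀ e ∈ links Λ, 0 ≤ c e) (Vbar : Site → ℝ) : ∃ V, IsPotential Λ S c Vbar V := by
  classical
  -- the antisymmetric drops are realised on oriented links, weighted by square roots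
  let D := Σ _ : {n // n ∈ Λ}, {m // m ∈ Λ}
  let w : D → ℝ := fun p => if lattice.Adj p.1.1 p.2.1 then √(c s(p.1.1, p.2.1)) else 0
  let T : (Site → ℝ) →ₗ[ℝ] EuclideanSpace ℝ D :=
    { toFun := fun φ => WithLp.toLp 2 fun p => (φ p.1.1 - φ p.2.1) * w p
      map_add' := fun φ ψ => by ext p; simp; ring
      map_smul' := fun a φ => by ext p; simp; ring }
  have hT : ∀ φ z, inner ℝ (T φ) (T z) = 2 * ∑ e ∈ links Λ, dropMul φ z e * c e := by
    intro φ z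
    rw [two_mul_sum_links, PiLp.inner_apply, Fintype.sum_sigma, ← Finset.sum_attach Λ]
    refine Finset.sum_congr rfl fun n _ => ?_
    rw [Finset.sum_filter, ← Finset.sum_attach Λ]
    refine Finset.sum_congr rfl fun m _ => ?_
    by_cases h : lattice.Adj n.1 m.1
    · have h0 : 0 ≤ c s(n.1, m.1) := hc _ (by simp [links, n.2, m.2, h])
      have h1 := Real.mul_self_sqrt h0
      simp only [T, w, h, LinearMap.coe_mk, AddHom.coe_mk, if_true, dropMul, Sym2.lift_mk,
        RCLike.inner_apply, conj_trivial]
      linear_combination ((φ n.1 - φ m.1) * (z n.1 - z m.1)) * h1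
    · simp [T, w, h]
  let Z : Submodule ℝ (Site → ℝ) :=
    { carrier := {z | ∀ n ∈ S, z n = 0}
      add_mem' := fun {a b} ha hb n hn => by simp [ha n hn, hb n hn]
      zero_mem' := fun _ _ => rfl
      smul_mem' := fun r a ha n hn => by simp [ha n hn] }
  obtain ⟨y, hy, u, hu, hyu⟩ := (Z.map T).exists_add_mem_mem_orthogonal (T Vbar)
  obtain ⟨z₀, hz₀, rfl⟩ := hy
  have hu' : u = T (Vbar - z₀) := by rw [map_sub, hyu]; abel
  refine ⟨Vbar - z₀, fun n hn => ?_, fun n hn hnS => ?_⟩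
  · simp [hz₀ n hn]
  · have hmem : (Pi.single n (1 : ℝ) : Site → ℝ) ∈ Z := fun k hk => by
      have : k ≠ n := fun h => hnS (h ▸ hk)
      simp [this]
    have h := (Submodule.mem_orthogonal' _ _).1 hu _ (Submodule.mem_map_of_mem (f := T) hmem)
    rw [hu', hT, sum_links_dropMul] at h
    simpa [Pi.single_apply, hn] using h

/-- All solutions of Kirchhoff's law dissipate the same power. -/
theorem dissipation_eq (Λ : Finset Site) (S : Set Site) (c : Sym2 Site → ℝ)
    (hc : ∀ e ∈ links Λ, 0 ≤ c e) (Vbar V : Site → ℝ) (hV : IsPotential Λ S c Vbar V) :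
    dissipation Λ S c Vbar = dissipationFunctional Λ c V := by
  have hU : IsPotential Λ S c Vbar (Classical.epsilon (IsPotential Λ S c Vbar)) :=
    Classical.epsilon_spec (exists_isPotential Λ S c hc Vbar)
  rw [dissipation]
  set U := Classical.epsilon (IsPotential Λ S c Vbar)
  have key : ∀ X, IsPotential Λ S c Vbar X →
      ∑ e ∈ links Λ, dropMul X (U - V) e * c e = 0 := by
    intro X hX
    rw [sum_links_dropMul]
    refine Finset.sum_eq_zero fun n hn => ?_
    by_cases h : n ∈ S
    · simp [hU.fixed n h, hV.fixed n h]
    · rw [hX.kirchhoff n hn h, zero_mul]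
  have h1 : dissipationFunctional Λ c U - dissipationFunctional Λ c V =
      ∑ e ∈ links Λ, dropMul U (U - V) e * c e + ∑ e ∈ links Λ, dropMul V (U - V) e * c e := by
    rw [dissipationFunctional, dissipationFunctional, ← Finset.sum_sub_distrib,
      ← Finset.sum_add_distrib]
    refine Finset.sum_congr rfl fun e _ => ?_
    induction e using Sym2.ind with
    | _ a b => simp only [sqDrop, dropMul, Sym2.lift_mk, Pi.sub_apply]; ring
  rw [key U hU, key V hV] at h1
  linarith

end ResistorNetwork

namespace ResistorNetwork

open scoped ENNReal

/-- A nonnegative stationary subadditive process with independent blocks: `X k n` is the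
value attached to the interval of length `n` starting at `k`. -/
structure IsSubadditiveProcess {Ω : Type*} [MeasurableSpace Ω] (P : Measure Ω)
    (X : ℕ → ℕ → Ω → ℝ) : Prop where
  measurable : ∀ k n, Measurable (X k n)
  nonneg : ∀ k n ω, 0 ≤ X k n ω
  zero : ∀ k ω, X k 0 ω = 0
  subadd : ∀ k m n ω, X k (m + n) ω ≤ X k m ω + X (k + m) n ω
  identDistrib : ∀ k, IdentDistrib (fun ω n => X k n ω) (fun ω n => X 0 n ω) P P
  indep : ∀ N, Pairwise fun i j => IndepFun (X (i * N) N) (X (j * N) N) P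
  integrable : Integrable (X 0 1) P

namespace IsSubadditiveProcess

variable {Ω : Type*} [MeasurableSpace Ω] {P : Measure Ω} {X : ℕ → ℕ → Ω → ℝ}

theorem le_sum_single (hX : IsSubadditiveProcess P X) (k n : ℕ) (ω : Ω) :
    X k n ω ≤ ∑ i ∈ Finset.range n, X (k + i) 1 ω := by
  induction n with
  | zero => simp [hX.zero]
  | succ n ih =>
    rw [Finset.sum_range_succ]
    linarith [hX.subadd k n 1 ω]

theorem le_sum_blocks (hX : IsSubadditiveProcess P X) (N q : ℕ) (ω : Ω) :
    X 0 (q * N) ω ≤ ∑ i ∈ Finset.range q, X (i * N) N ω := by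
  induction q with
  | zero => simp [hX.zero]
  | succ q ih =>
    rw [Finset.sum_range_succ, Nat.succ_mul]
    have := hX.subadd 0 (q * N) N ω
    rw [Nat.zero_add] at this
    linarith

theorem identDistrib_apply (hX : IsSubadditiveProcess P X) (k n : ℕ) :
    IdentDistrib (X k n) (X 0 n) P P :=
  (hX.identDistrib k).comp (measurable_pi_apply n)

theorem integral_eq (hX : IsSubadditiveProcess P X) (k n : ℕ) :
    ∫ ω, X k n ω ∂P = ∫ ω, X 0 n ω ∂P :=
  (hX.identDistrib_apply k n).integral_eq

theorem integrable_apply (hX : IsSubadditiveProcess P X) (k n : ℕ) : Integrable (X k n) P := by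
  refine Integrable.mono' (g := fun ω => ∑ i ∈ Finset.range n, X (k + i) 1 ω) ?_
    (hX.measurable k n).aestronglyMeasurable (ae_of_all _ fun ω => ?_)
  · exact integrable_finsetSum _ fun i _ => (hX.identDistrib_apply (k + i) 1).integrable_iff.2
      hX.integrable
  · rw [Real.norm_of_nonneg (hX.nonneg k n ω)]
    exact hX.le_sum_single k n ω

theorem subadditive (hX : IsSubadditiveProcess P X) :
    Subadditive fun n => ∫ ω, X 0 n ω ∂P := by
  intro m n
  beta_reduce
  rw [← hX.integral_eq (0 + m) n,
    ← integral_add (hX.integrable_apply 0 m) (hX.integrable_apply (0 + m) n)]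
  exact integral_mono (hX.integrable_apply 0 (m + n))
    ((hX.integrable_apply 0 m).add (hX.integrable_apply (0 + m) n)) fun ω => hX.subadd 0 m n ω

theorem bddBelow (hX : IsSubadditiveProcess P X) :
    BddBelow (Set.range fun n : ℕ => (∫ ω, X 0 n ω ∂P) / n) :=
  ⟨0, by
    rintro _ ⟨n, rfl⟩
    exact div_nonneg (integral_nonneg (hX.nonneg 0 n)) n.cast_nonneg⟩

/-! ### The upper bound -/

theorem ae_tendsto_blocks (hX : IsSubadditiveProcess P X) (N : ℕ) :
    ∀ᵐ ω ∂P, Tendsto (fun q : ℕ => (∑ i ∈ Finset.range q, X (i * N) N ω) / q) atTop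
      (𝓝 (∫ ω, X 0 N ω ∂P)) := by
  have h := strong_law_ae_real (fun i => X (i * N) N) (hX.integrable_apply (0 * N) N)
    (hX.indep N) (fun i => (hX.identDistrib_apply (i * N) N).trans
      (hX.identDistrib_apply (0 * N) N).symm)
  simpa only [Nat.zero_mul] using h

theorem ae_eventually_le_block (hX : IsSubadditiveProcess P X) (N : ℕ) (hN : 0 < N) :
    ∀ᵐ ω ∂P, ∀ a, (∫ ω, X 0 N ω ∂P) / N < a → ∀ᶠ n : ℕ in atTop, X 0 n ω / n < a := by
  filter_upwards [hX.ae_tendsto_blocks N, hX.ae_tendsto_blocks 1] with ω h1 h2 a ha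
  have hq : Tendsto (fun n : ℕ => n / N) atTop atTop := Nat.tendsto_div_const_atTop hN.ne'
  have hr : Tendsto (fun n : ℕ => ((n / N : ℕ) : ℝ) / n) atTop (𝓝 (1 / N)) := by
    have := (tendsto_nat_floor_mul_div_atTop (R := ℝ) (a := 1 / N) (by positivity)).comp
      tendsto_natCast_atTop_atTop
    refine this.congr fun n => ?_
    simp only [Function.comp]
    rw [one_div_mul_eq_div, Nat.floor_div_eq_div]
  set S : ℕ → ℝ := fun n => ∑ i ∈ Finset.range n, X i 1 ω with hS
  set m := ∫ ω, X 0 1 ω ∂P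
  have h2' : Tendsto (fun n : ℕ => S n / n) atTop (𝓝 m) := by simpa [hS] using h2
  have h3 : Tendsto (fun n : ℕ => S (n / N * N) / ((n / N * N : ℕ) : ℝ)) atTop (𝓝 m) :=
    h2'.comp ((tendsto_id.atTop_mul_const' hN).comp hq)
  have h4 : Tendsto (fun n : ℕ =>
      ((∑ i ∈ Finset.range (n / N), X (i * N) N ω) / ((n / N : ℕ) : ℝ)) *
        (((n / N : ℕ) : ℝ) / n) + (S n / n -
        S (n / N * N) / ((n / N * N : ℕ) : ℝ) * ((((n / N : ℕ) : ℝ) / n) * N))) atTop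
      (𝓝 ((∫ ω, X 0 N ω ∂P) * (1 / N) + (m - m * (1 / N * N)))) :=
    ((h1.comp hq).mul hr).add (h2'.sub (h3.mul (hr.mul_const _)))
  have hN' : (N : ℝ) ≠ 0 := by positivity
  have h5 : (∫ ω, X 0 N ω ∂P) * (1 / N) + (m - m * (1 / N * N)) < a := by
    rw [one_div_mul_cancel hN', mul_one_div]; linarith
  filter_upwards [h4.eventually_lt_const h5, eventually_ge_atTop N] with n hn hnN
  refine lt_of_le_of_lt ?_ hn
  have hn0 : (0 : ℝ) < n := by exact_mod_cast hN.trans_le hnN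
  have hq0 : (0 : ℝ) < ((n / N : ℕ) : ℝ) := by exact_mod_cast Nat.div_pos hnN hN
  have e1 : X 0 n ω ≤ ∑ i ∈ Finset.range (n / N), X (i * N) N ω + (S n - S (n / N * N)) := by
    have hdm : n / N * N + n % N = n := Nat.div_add_mod' n N
    have a1 := hX.subadd 0 (n / N * N) (n % N) ω
    have a2 := hX.le_sum_blocks N (n / N) ω
    have a3 := hX.le_sum_single (0 + n / N * N) (n % N) ω
    have a4 : S n - S (n / N * N) = ∑ i ∈ Finset.range (n % N), X (n / N * N + i) 1 ω := by
      rw [sub_eq_iff_eq_add', hS]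
      simp only
      rw [← Finset.sum_range_add, hdm]
    rw [hdm] at a1
    rw [a4]
    rw [Nat.zero_add] at a1 a3
    linarith
  calc X 0 n ω / n ≤ (∑ i ∈ Finset.range (n / N), X (i * N) N ω + (S n - S (n / N * N))) / n := by
        gcongr
    _ = _ := by
        push_cast
        field_simp

theorem ae_eventually_lt (hX : IsSubadditiveProcess P X) :
    ∀ᵐ ω ∂P, ∀ a, hX.subadditive.lim < a → ∀ᶠ n : ℕ in atTop, X 0 n ω / n < a := by
  have h : ∀ᵐ ω ∂P, ∀ N : ℕ, 0 < N → ∀ a, (∫ ω, X 0 N ω ∂P) / N < a →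
      ∀ᶠ n : ℕ in atTop, X 0 n ω / n < a := by
    rw [ae_all_iff]
    intro N
    by_cases hN : 0 < N
    · filter_upwards [hX.ae_eventually_le_block N hN] with ω h _ using h
    · exact ae_of_all _ fun ω h => absurd h hN
  filter_upwards [h] with ω h a ha
  obtain ⟨N, hN, hN0⟩ := (((hX.subadditive.tendsto_lim hX.bddBelow).eventually_lt_const ha).and
    (eventually_gt_atTop 0)).exists
  exact h N hN0 a hN

end IsSubadditiveProcess

theorem tendsto_const_div_natCast_nhds_zero {a : ℝ≥0∞} (ha : a ≠ ∞) :
    Tendsto (fun n : ℕ => a / n) atTop (𝓝 0) := by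
  simpa using ENNReal.Tendsto.const_div ENNReal.tendsto_nat_nhds_top (Or.inr ha)

/-- The lower density of a sequence of reals. -/
noncomputable def lowerDensity (x : ℕ → ℝ) : ℝ≥0∞ :=
  liminf (fun n : ℕ => ENNReal.ofReal (x n) / n) atTop

theorem measurable_lowerDensity : Measurable lowerDensity :=
  Measurable.liminf fun n => by fun_prop

/-- The sequences whose density does not come within `ε` of their lower density up to time `M`. -/
def lateSet (ε : ℝ≥0∞) (M : ℕ) : Set (ℕ → ℝ) :=
  {x | ∀ n ∈ Finset.Icc 1 M, n * (lowerDensity x + ε) < ENNReal.ofReal (x n)}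

theorem measurableSet_lateSet (ε : ℝ≥0∞) (M : ℕ) : MeasurableSet (lateSet ε M) := by
  have : lateSet ε M = ⋂ n ∈ Finset.Icc 1 M,
      {x : ℕ → ℝ | n * (lowerDensity x + ε) < ENNReal.ofReal (x n)} := by
    ext x; simp [lateSet]
  rw [this]
  refine Finset.measurableSet_biInter _ fun n _ => measurableSet_lt ?_ (by fun_prop)
  exact (measurable_lowerDensity.add_const ε).const_mul _

theorem eventually_notMem_lateSet {x : ℕ → ℝ} (hx : lowerDensity x ≠ ∞) {ε : ℝ≥0∞}
    (hε : ε ≠ 0) : ∀ᶠ M in atTop, x ∉ lateSet ε M := by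
  have h : lowerDensity x < lowerDensity x + ε := ENNReal.lt_add_right hx hε
  have h1 : ∃ᶠ n : ℕ in atTop, ENNReal.ofReal (x n) / n < lowerDensity x + ε :=
    frequently_lt_of_liminf_lt (by isBoundedDefault) h
  obtain ⟨n, hn, hn0⟩ := (h1.and_eventually (eventually_gt_atTop 0)).exists
  filter_upwards [eventually_ge_atTop n] with M hM hmem
  refine (hmem n (Finset.mem_Icc.2 ⟨hn0, hM⟩)).not_ge ?_
  rw [mul_comm]
  exact (ENNReal.div_le_iff (by exact_mod_cast hn0.ne') (ENNReal.natCast_ne_top n)).1 hn.le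

/-- The cost of a unit step from which no short interval of near-minimal density starts. -/
noncomputable def lateCost (ε : ℝ≥0∞) (M : ℕ) (x : ℕ → ℝ) : ℝ≥0∞ :=
  (lateSet ε M).indicator (fun x => ENNReal.ofReal (x 1)) x

theorem measurable_lateCost (ε : ℝ≥0∞) (M : ℕ) : Measurable (lateCost ε M) :=
  Measurable.indicator (by fun_prop) (measurableSet_lateSet ε M)

namespace IsSubadditiveProcess

variable {Ω : Type*} [MeasurableSpace Ω] {P : Measure Ω} {X : ℕ → ℕ → Ω → ℝ}

theorem lintegral_comp_eq (hX : IsSubadditiveProcess P X) {F : (ℕ → ℝ) → ℝ≥0∞}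
    (hF : Measurable F) (k : ℕ) :
    ∫⁻ ω, F (fun n => X k n ω) ∂P = ∫⁻ ω, F (fun n => X 0 n ω) ∂P :=
  ((hX.identDistrib k).comp hF).lintegral_eq

theorem measurable_process (hX : IsSubadditiveProcess P X) (k : ℕ) :
    Measurable fun ω n => X k n ω :=
  measurable_pi_lambda _ fun n => hX.measurable k n

theorem lowerDensity_le_succ (hX : IsSubadditiveProcess P X) (k : ℕ) (ω : Ω) :
    lowerDensity (fun n => X k n ω) ≤ lowerDensity (fun n => X (k + 1) n ω) := by
  have h0 : Tendsto (fun n : ℕ => ENNReal.ofReal (X k 1 ω) / ((n + 1 : ℕ) : ℝ≥0∞)) atTop (𝓝 0) :=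
    (tendsto_const_div_natCast_nhds_zero ENNReal.ofReal_ne_top).comp
      (tendsto_add_atTop_nat 1)
  have h1 : lowerDensity (fun n => X k n ω) =
      liminf (fun n : ℕ => ENNReal.ofReal (X k (n + 1) ω) / ((n + 1 : ℕ) : ℝ≥0∞)) atTop :=
    (liminf_nat_add (fun n : ℕ => ENNReal.ofReal (X k n ω) / (n : ℝ≥0∞)) 1).symm
  refine le_of_forall_gt_imp_ge_of_dense fun a ha => ?_
  obtain ⟨b, hb, hba⟩ := exists_between ha
  have hfreq : ∃ᶠ n : ℕ in atTop, ENNReal.ofReal (X (k + 1) n ω) / n < b :=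
    frequently_lt_of_liminf_lt (by isBoundedDefault) hb
  have hab : 0 < a - b := tsub_pos_of_lt hba
  rw [h1]
  refine liminf_le_of_frequently_le' ?_
  refine (hfreq.and_eventually (h0.eventually_lt_const hab)).mono fun n ⟨hn, hn'⟩ => ?_
  calc ENNReal.ofReal (X k (n + 1) ω) / ((n + 1 : ℕ) : ℝ≥0∞)
      ≤ (ENNReal.ofReal (X k 1 ω) + ENNReal.ofReal (X (k + 1) n ω)) / ((n + 1 : ℕ) : ℝ≥0∞) := by
        gcongr
        rw [← ENNReal.ofReal_add (hX.nonneg _ _ _) (hX.nonneg _ _ _), Nat.add_comm]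
        exact ENNReal.ofReal_le_ofReal (hX.subadd k 1 n ω)
    _ = ENNReal.ofReal (X k 1 ω) / ((n + 1 : ℕ) : ℝ≥0∞) +
        ENNReal.ofReal (X (k + 1) n ω) / ((n + 1 : ℕ) : ℝ≥0∞) := ENNReal.add_div
    _ ≤ (a - b) + ENNReal.ofReal (X (k + 1) n ω) / n := by
        gcongr
        exact Nat.le_succ n
    _ ≤ (a - b) + b := by gcongr
    _ = a := tsub_add_cancel_of_le hba.le

theorem ae_lowerDensity_le (hX : IsSubadditiveProcess P X) :
    ∀ᵐ ω ∂P, lowerDensity (fun n => X 0 n ω) ≤ ENNReal.ofReal hX.subadditive.lim := by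
  have hlim0 : 0 ≤ hX.subadditive.lim :=
    ge_of_tendsto' (hX.subadditive.tendsto_lim hX.bddBelow) fun n =>
      div_nonneg (integral_nonneg (hX.nonneg 0 n)) n.cast_nonneg
  filter_upwards [hX.ae_eventually_lt] with ω h
  refine le_of_forall_gt_imp_ge_of_dense fun a ha => ?_
  rcases eq_or_ne a ∞ with rfl | hat
  · exact le_top
  have ha' : hX.subadditive.lim < a.toReal := (ENNReal.ofReal_lt_iff_lt_toReal hlim0 hat).1 ha
  refine liminf_le_of_frequently_le' ((((h _ ha').and (eventually_gt_atTop 0)).frequently).mono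
    fun n ⟨hn, hn0⟩ => ?_)
  have hn0' : (0 : ℝ) < n := by exact_mod_cast hn0
  rw [← ENNReal.ofReal_natCast, ← ENNReal.ofReal_div_of_pos hn0', ← ENNReal.ofReal_toReal hat]
  exact ENNReal.ofReal_le_ofReal hn.le

theorem ae_lowerDensity_eq [IsProbabilityMeasure P] (hX : IsSubadditiveProcess P X) :
    ∀ᵐ ω ∂P, ∀ k, lowerDensity (fun n => X k n ω) = lowerDensity (fun n => X 0 n ω) := by
  have hfin : ∀ k, ∫⁻ ω, lowerDensity (fun n => X k n ω) ∂P ≠ ∞ := fun k => by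
    rw [hX.lintegral_comp_eq measurable_lowerDensity k]
    refine ne_top_of_le_ne_top ?_ (lintegral_mono_ae hX.ae_lowerDensity_le)
    simp
  have h : ∀ᵐ ω ∂P, ∀ k, lowerDensity (fun n => X k n ω) =
      lowerDensity (fun n => X (k + 1) n ω) := by
    rw [ae_all_iff]
    intro k
    refine ae_eq_of_ae_le_of_lintegral_le (ae_of_all _ (hX.lowerDensity_le_succ k)) (hfin k)
      (measurable_lowerDensity.comp (hX.measurable_process (k + 1))).aemeasurable ?_
    rw [hX.lintegral_comp_eq measurable_lowerDensity k,
      hX.lintegral_comp_eq measurable_lowerDensity (k + 1)]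
  filter_upwards [h] with ω h k
  induction k with
  | zero => rfl
  | succ k ih => rw [← h k, ih]

/-! ### The lower bound: a greedy covering by intervals of nearly minimal density -/

theorem greedy_cover (hX : IsSubadditiveProcess P X) (ω : Ω) {f : ℝ≥0∞}
    (hf : ∀ k, lowerDensity (fun n => X k n ω) = f) (ε : ℝ≥0∞) (M : ℕ) (L k : ℕ) :
    ENNReal.ofReal (X k L ω) ≤ L * (f + ε) +
      ∑ i ∈ Finset.Ico k (k + L), lateCost ε M (fun n => X i n ω) +
      ∑ i ∈ Finset.Ico (k + L - M) (k + L), ENNReal.ofReal (X i 1 ω) := by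
  induction L using Nat.strong_induction_on generalizing k with
  | _ L ih =>
  have hsplit : ∀ m n, ENNReal.ofReal (X k (m + n) ω) ≤
      ENNReal.ofReal (X k m ω) + ENNReal.ofReal (X (k + m) n ω) := fun m n => by
    rw [← ENNReal.ofReal_add (hX.nonneg _ _ _) (hX.nonneg _ _ _)]
    exact ENNReal.ofReal_le_ofReal (hX.subadd k m n ω)
  rcases le_or_gt L M with hLM | hLM
  · refine le_trans ?_ le_add_self
    calc ENNReal.ofReal (X k L ω)
        ≤ ENNReal.ofReal (∑ i ∈ Finset.range L, X (k + i) 1 ω) :=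
          ENNReal.ofReal_le_ofReal (hX.le_sum_single k L ω)
      _ = ∑ i ∈ Finset.Ico k (k + L), ENNReal.ofReal (X i 1 ω) := by
          rw [ENNReal.ofReal_sum_of_nonneg fun i _ => hX.nonneg _ _ _,
            Finset.sum_Ico_eq_sum_range, Nat.add_sub_cancel_left]
      _ ≤ _ := Finset.sum_le_sum_of_subset (Finset.Ico_subset_Ico (by omega) le_rfl)
  · by_cases hlate : (fun n => X k n ω) ∈ lateSet ε M
    · obtain ⟨l, rfl⟩ : ∃ l, L = 1 + l := ⟨L - 1, by omega⟩
      have h1 := ih l (by omega) (k + 1)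
      have h2 : ENNReal.ofReal (X k 1 ω) = lateCost ε M (fun n => X k n ω) := by
        rw [lateCost, Set.indicator_of_mem hlate]
      rw [add_assoc k 1 l] at h1
      calc ENNReal.ofReal (X k (1 + l) ω)
          ≤ ENNReal.ofReal (X k 1 ω) + ENNReal.ofReal (X (k + 1) l ω) := hsplit 1 l
        _ ≤ lateCost ε M (fun n => X k n ω) + (l * (f + ε) +
            ∑ i ∈ Finset.Ico (k + 1) (k + (1 + l)), lateCost ε M (fun n => X i n ω) +
            ∑ i ∈ Finset.Ico (k + (1 + l) - M) (k + (1 + l)), ENNReal.ofReal (X i 1 ω)) := by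
            rw [h2]; gcongr
        _ = l * (f + ε) +
            ∑ i ∈ Finset.Ico k (k + (1 + l)), lateCost ε M (fun n => X i n ω) +
            ∑ i ∈ Finset.Ico (k + (1 + l) - M) (k + (1 + l)), ENNReal.ofReal (X i 1 ω) := by
            rw [Finset.sum_eq_sum_Ico_succ_bot (show k < k + (1 + l) by omega)]
            ring
        _ ≤ _ := by
            gcongr
            omega
    · obtain ⟨m, hm, hle⟩ : ∃ m ∈ Finset.Icc 1 M,
          ENNReal.ofReal (X k m ω) ≤ m * (f + ε) := by
        simpa [lateSet, hf k, and_assoc] using hlate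
      rw [Finset.mem_Icc] at hm
      obtain ⟨l, rfl⟩ : ∃ l, L = m + l := ⟨L - m, by omega⟩
      have h1 := ih l (by omega) (k + m)
      rw [add_assoc k m l] at h1
      calc ENNReal.ofReal (X k (m + l) ω)
          ≤ ENNReal.ofReal (X k m ω) + ENNReal.ofReal (X (k + m) l ω) := hsplit m l
        _ ≤ m * (f + ε) + (l * (f + ε) +
            ∑ i ∈ Finset.Ico k (k + (m + l)), lateCost ε M (fun n => X i n ω) +
            ∑ i ∈ Finset.Ico (k + (m + l) - M) (k + (m + l)), ENNReal.ofReal (X i 1 ω)) := by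
            refine add_le_add hle (h1.trans ?_)
            gcongr
            omega
        _ = _ := by push_cast; ring

theorem ofReal_lim_le_lintegral_add [IsProbabilityMeasure P] (hX : IsSubadditiveProcess P X)
    (ε : ℝ≥0∞) (M : ℕ) :
    ENNReal.ofReal hX.subadditive.lim ≤ (∫⁻ ω, lowerDensity (fun n => X 0 n ω) ∂P) + ε +
      ∫⁻ ω, lateCost ε M (fun n => X 0 n ω) ∂P := by
  set F := ∫⁻ ω, lowerDensity (fun n => X 0 n ω) ∂P
  set B := ∫⁻ ω, lateCost ε M (fun n => X 0 n ω) ∂P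
  set m := ∫⁻ ω, ENNReal.ofReal (X 0 1 ω) ∂P
  have hm : m ≠ ∞ := by
    rw [← lt_top_iff_ne_top]
    exact hX.integrable.lintegral_lt_top
  have hmeasD : Measurable fun ω => lowerDensity (fun n => X 0 n ω) :=
    measurable_lowerDensity.comp (hX.measurable_process 0)
  have hmeasB : ∀ i, Measurable fun ω => lateCost ε M (fun n => X i n ω) := fun i =>
    (measurable_lateCost ε M).comp (hX.measurable_process i)
  have hmeas1 : ∀ i, Measurable fun ω => ENNReal.ofReal (X i 1 ω) := fun i =>
    (hX.measurable i 1).ennreal_ofReal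
  have hbound : ∀ L : ℕ, ENNReal.ofReal (∫ ω, X 0 L ω ∂P) ≤ L * (F + ε) + L * B + M * m := by
    intro L
    rw [ofReal_integral_eq_lintegral_ofReal (hX.integrable_apply 0 L)
      (ae_of_all _ (hX.nonneg 0 L))]
    calc ∫⁻ ω, ENNReal.ofReal (X 0 L ω) ∂P
        ≤ ∫⁻ ω, (L * (lowerDensity (fun n => X 0 n ω) + ε) +
          ∑ i ∈ Finset.Ico 0 (0 + L), lateCost ε M (fun n => X i n ω) +
          ∑ i ∈ Finset.Ico (0 + L - M) (0 + L), ENNReal.ofReal (X i 1 ω)) ∂P := by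
          refine lintegral_mono_ae ?_
          filter_upwards [hX.ae_lowerDensity_eq] with ω h
          exact hX.greedy_cover ω h ε M L 0
      _ = L * (F + ε) + L * B + (0 + L - (0 + L - M) : ℕ) * m := by
          rw [lintegral_add_right _ (Finset.measurable_fun_sum _ fun i _ => hmeas1 i),
            lintegral_add_right _ (Finset.measurable_fun_sum _ fun i _ => hmeasB i),
            lintegral_const_mul _ (hmeasD.add_const ε), lintegral_add_right _ measurable_const,
            lintegral_finsetSum _ fun i _ => hmeasB i,
            lintegral_finsetSum _ fun i _ => hmeas1 i]
          have e1 : ∀ i, ∫⁻ ω, lateCost ε M (fun n => X i n ω) ∂P = B :=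
            hX.lintegral_comp_eq (measurable_lateCost ε M)
          have e2 : ∀ i, ∫⁻ ω, ENNReal.ofReal (X i 1 ω) ∂P = m :=
            hX.lintegral_comp_eq (F := fun x => ENNReal.ofReal (x 1)) (by fun_prop)
          simp [e1, e2, F]
      _ ≤ _ := by
          gcongr
          omega
  have hlim : Tendsto (fun L : ℕ => F + ε + B + M * m / L) atTop (𝓝 (F + ε + B + 0)) :=
    tendsto_const_nhds.add (tendsto_const_div_natCast_nhds_zero
      (ENNReal.mul_ne_top (ENNReal.natCast_ne_top M) hm))
  rw [add_zero] at hlim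
  refine ge_of_tendsto hlim ?_
  filter_upwards [eventually_gt_atTop 0] with L hL
  have hL0 : (0 : ℝ) < L := by exact_mod_cast hL
  have hL1 : (L : ℝ≥0∞) ≠ 0 := by exact_mod_cast hL.ne'
  calc ENNReal.ofReal hX.subadditive.lim ≤ ENNReal.ofReal ((∫ ω, X 0 L ω ∂P) / L) :=
        ENNReal.ofReal_le_ofReal (hX.subadditive.lim_le_div hX.bddBelow hL.ne')
    _ = ENNReal.ofReal (∫ ω, X 0 L ω ∂P) / L := by
        rw [ENNReal.ofReal_div_of_pos hL0, ENNReal.ofReal_natCast]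
    _ ≤ (L * (F + ε) + L * B + M * m) / L := by
        gcongr
        exact hbound L
    _ = F + ε + B + M * m / L := by
        rw [← mul_add, ENNReal.add_div, mul_comm (L : ℝ≥0∞),
          ENNReal.mul_div_cancel_right hL1 (ENNReal.natCast_ne_top L)]

theorem tendsto_lintegral_lateCost [IsProbabilityMeasure P] (hX : IsSubadditiveProcess P X)
    {ε : ℝ≥0∞} (hε : ε ≠ 0) :
    Tendsto (fun M => ∫⁻ ω, lateCost ε M (fun n => X 0 n ω) ∂P) atTop (𝓝 0) := by
  rw [← lintegral_zero (μ := P)]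
  refine tendsto_lintegral_of_dominated_convergence (fun ω => ENNReal.ofReal (X 0 1 ω))
    (fun M => (measurable_lateCost ε M).comp (hX.measurable_process 0))
    (fun M => ae_of_all _ fun ω => Set.indicator_le_self _ _ _)
    hX.integrable.lintegral_lt_top.ne ?_
  filter_upwards [hX.ae_lowerDensity_le] with ω h
  refine tendsto_const_nhds.congr' ?_
  filter_upwards [eventually_notMem_lateSet (ne_top_of_le_ne_top ENNReal.ofReal_ne_top h) hε]
    with M hM
  rw [lateCost, Set.indicator_of_notMem hM]

theorem ae_lowerDensity_eq_lim [IsProbabilityMeasure P] (hX : IsSubadditiveProcess P X) :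
    ∀ᵐ ω ∂P, lowerDensity (fun n => X 0 n ω) = ENNReal.ofReal hX.subadditive.lim := by
  refine ae_eq_of_ae_le_of_lintegral_le hX.ae_lowerDensity_le ?_ aemeasurable_const ?_
  · refine ne_top_of_le_ne_top ?_ (lintegral_mono_ae hX.ae_lowerDensity_le)
    simp
  · rw [lintegral_const, measure_univ, mul_one]
    refine ENNReal.le_of_forall_pos_le_add fun ε hε _ => ?_
    have hε' : (ε : ℝ≥0∞) ≠ 0 := by exact_mod_cast hε.ne'
    have h := (tendsto_const_nhds (x := (∫⁻ ω, lowerDensity (fun n => X 0 n ω) ∂P) + ε)).add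
      (hX.tendsto_lintegral_lateCost hε')
    rw [add_zero] at h
    exact ge_of_tendsto' h fun M => hX.ofReal_lim_le_lintegral_add ε M

/-- The subadditive ergodic theorem for processes with independent blocks. -/
theorem ae_tendsto [IsProbabilityMeasure P] (hX : IsSubadditiveProcess P X) :
    ∀ᵐ ω ∂P, Tendsto (fun n : ℕ => X 0 n ω / n) atTop (𝓝 hX.subadditive.lim) := by
  filter_upwards [hX.ae_eventually_lt, hX.ae_lowerDensity_eq_lim] with ω h1 h2
  rw [tendsto_order]
  refine ⟨fun a ha => ?_, fun a ha => h1 a ha⟩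
  rcases lt_or_ge a 0 with ha0 | ha0
  · exact Eventually.of_forall fun n => ha0.trans_le
      (div_nonneg (hX.nonneg 0 n ω) n.cast_nonneg)
  have h3 : ENNReal.ofReal a < lowerDensity (fun n => X 0 n ω) := by
    rw [h2]
    exact (ENNReal.ofReal_lt_ofReal_iff (ha0.trans_lt ha)).2 ha
  filter_upwards [eventually_lt_of_lt_liminf h3, eventually_gt_atTop 0] with n hn hn0
  have hn0' : (0 : ℝ) < n := by exact_mod_cast hn0
  rw [← ENNReal.ofReal_natCast n, ← ENNReal.ofReal_div_of_pos hn0'] at hn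
  exact (ENNReal.ofReal_lt_ofReal_iff_of_nonneg ha0).1 hn

end IsSubadditiveProcess

/-- The forward neighbours of a site: to the right (`false`) and above (`true`). -/
def forward (n : Site) : Bool → Site
  | false => (n.1 + 1, n.2)
  | true => (n.1, n.2 + 1)

/-- The energy on the two links from a site to its forward neighbours; a link is indexed by its
lower left site and its direction. -/
def cellEnergy (c : Site × Bool → ℝ) (φ : Site → ℝ) (n : Site) : ℝ :=
  ∑ b, (φ (forward n b) - φ n) ^ 2 * |c (n, b)|

theorem cellEnergy_nonneg (c : Site × Bool → ℝ) (φ : Site → ℝ) (n : Site) :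
    0 ≤ cellEnergy c φ n :=
  Finset.sum_nonneg fun _ _ => by positivity

/-- The potentials which agree with the longitudinal coordinate outside `I`. -/
abbrev Admissible (I : Set Site) : Type := {φ : Site → ℝ // ∀ n, n ∉ I → φ n = n.1}

instance (I : Set Site) : Nonempty (Admissible I) := ⟨⟨fun n => n.1, fun _ _ => rfl⟩⟩

/-- The minimal energy on the cells `Q` of a potential which is free on `I` only. -/
noncomputable def minEnergy (Q : Finset Site) (I : Set Site) (c : Site × Bool → ℝ) : ℝ :=
  ⨅ φ : Admissible I, ∑ n ∈ Q, cellEnergy c φ.1 n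

theorem bddBelow_energy (Q : Finset Site) (I : Set Site) (c : Site × Bool → ℝ) :
    BddBelow (Set.range fun φ : Admissible I => ∑ n ∈ Q, cellEnergy c φ.1 n) :=
  ⟨0, by rintro _ ⟨φ, rfl⟩; exact Finset.sum_nonneg fun n _ => cellEnergy_nonneg c φ.1 n⟩

theorem minEnergy_le {Q : Finset Site} {I : Set Site} (c : Site × Bool → ℝ) (φ : Admissible I) :
    minEnergy Q I c ≤ ∑ n ∈ Q, cellEnergy c φ.1 n :=
  ciInf_le (bddBelow_energy Q I c) φ

theorem minEnergy_nonneg (Q : Finset Site) (I : Set Site) (c : Site × Bool → ℝ) :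
    0 ≤ minEnergy Q I c :=
  le_ciInf fun φ => Finset.sum_nonneg fun n _ => cellEnergy_nonneg c φ.1 n

theorem minEnergy_empty (I : Set Site) (c : Site × Bool → ℝ) : minEnergy ∅ I c = 0 := by
  simp [minEnergy]

theorem minEnergy_congr {Q : Finset Site} (I : Set Site) {c c' : Site × Bool → ℝ}
    (h : ∀ n ∈ Q, ∀ b, c (n, b) = c' (n, b)) : minEnergy Q I c = minEnergy Q I c' := by
  unfold minEnergy cellEnergy
  congr 1 with φ
  exact Finset.sum_congr rfl fun n hn => Finset.sum_congr rfl fun b _ => by rw [h n hn b]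

theorem minEnergy_le_sum (Q : Finset Site) (I : Set Site) (c : Site × Bool → ℝ) :
    minEnergy Q I c ≤ ∑ n ∈ Q, |c (n, false)| := by
  refine (minEnergy_le c ⟨fun n => n.1, fun _ _ => rfl⟩).trans_eq ?_
  refine Finset.sum_congr rfl fun n _ => ?_
  simp [cellEnergy, forward]

theorem measurable_minEnergy (Q : Finset Site) (I : Set Site) : Measurable (minEnergy Q I) := by
  refine UpperSemicontinuous.measurable (upperSemicontinuous_ciInf (bddBelow_energy Q I) fun φ => ?_)
  refine Continuous.upperSemicontinuous ?_
  unfold cellEnergy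
  fun_prop

theorem minEnergy_union_le {Q Q₁ Q₂ : Finset Site} {I I₁ I₂ : Set Site} (hQ : Q ⊆ Q₁ ∪ Q₂)
    (hI₁ : I₁ ⊆ I) (hI₂ : I₂ ⊆ I)
    (h₁ : ∀ n ∈ Q₁, n ∉ I₂ ∧ ∀ b, forward n b ∉ I₂)
    (h₂ : ∀ n ∈ Q₂, n ∉ I₁ ∧ ∀ b, forward n b ∉ I₁) (c : Site × Bool → ℝ) :
    minEnergy Q I c ≤ minEnergy Q₁ I₁ c + minEnergy Q₂ I₂ c := by
  classical
  refine le_ciInf_add_ciInf fun φ₁ φ₂ => ?_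
  let φ : Site → ℝ := fun n => if n ∈ I₁ then φ₁.1 n else φ₂.1 n
  have hφ : ∀ n, n ∉ I → φ n = n.1 := fun n hn => by
    have a1 : n ∉ I₁ := fun h => hn (hI₁ h)
    have a2 : n ∉ I₂ := fun h => hn (hI₂ h)
    simp [φ, a1, φ₂.2 n a2]
  have e1 : ∀ n, n ∉ I₂ → φ n = φ₁.1 n := fun n hn => by
    by_cases h : n ∈ I₁
    · simp [φ, h]
    · simp [φ, h, φ₂.2 n hn, φ₁.2 n h]
  have e2 : ∀ n, n ∉ I₁ → φ n = φ₂.1 n := fun n hn => by simp [φ, hn]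
  calc minEnergy Q I c ≤ ∑ n ∈ Q, cellEnergy c φ n := minEnergy_le c ⟨φ, hφ⟩
    _ ≤ ∑ n ∈ Q₁ ∪ Q₂, cellEnergy c φ n :=
        Finset.sum_le_sum_of_subset_of_nonneg hQ fun n _ _ => cellEnergy_nonneg c φ n
    _ ≤ ∑ n ∈ Q₁, cellEnergy c φ n + ∑ n ∈ Q₂, cellEnergy c φ n := by
        rw [← Finset.sum_union_inter]
        exact le_add_of_nonneg_right (Finset.sum_nonneg fun n _ => cellEnergy_nonneg c φ n)
    _ = ∑ n ∈ Q₁, cellEnergy c φ₁.1 n + ∑ n ∈ Q₂, cellEnergy c φ₂.1 n := by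
        congr 1
        · refine Finset.sum_congr rfl fun n hn => ?_
          simp only [cellEnergy, e1 n (h₁ n hn).1, e1 _ ((h₁ n hn).2 _)]
        · refine Finset.sum_congr rfl fun n hn => ?_
          simp only [cellEnergy, e2 n (h₂ n hn).1, e2 _ ((h₂ n hn).2 _)]

/-- The lower left sites of the links of a rectangle with corner `p`. -/
noncomputable def cells (p : Site) (L A : ℕ) : Finset Site :=
  Finset.Ico p.1 (p.1 + L) ×ˢ Finset.Ico p.2 (p.2 + A)

/-- The interior sites of the rectangle with corner `p`. -/
def boxInterior (p : Site) (L A : ℕ) : Set Site :=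
  {n | (p.1 < n.1 ∧ n.1 < p.1 + L) ∧ p.2 < n.2 ∧ n.2 + 1 < p.2 + A}

theorem mem_cells {p n : Site} {L A : ℕ} :
    n ∈ cells p L A ↔ (p.1 ≤ n.1 ∧ n.1 < p.1 + L) ∧ p.2 ≤ n.2 ∧ n.2 < p.2 + A := by
  simp [cells]

theorem card_cells (p : Site) (L A : ℕ) : (cells p L A).card = L * A := by
  simp [cells]

/-- The dissipation, at unit strength of the applied field, of the rectangle with corner `p`. -/
noncomputable def boxEnergy (p : Site) (L A : ℕ) (c : Site × Bool → ℝ) : ℝ :=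
  minEnergy (cells p L A) (boxInterior p L A) c

theorem boxEnergy_add_left_le (p : Site) (L L' A : ℕ) (c : Site × Bool → ℝ) :
    boxEnergy p (L + L') A c ≤ boxEnergy p L A c + boxEnergy (p.1 + L, p.2) L' A c := by
  refine minEnergy_union_le (fun n => ?_) (fun n => ?_) (fun n => ?_) (fun n hn => ?_)
    (fun n hn => ?_) c
  · simp only [Finset.mem_union, mem_cells]; push_cast; omega
  · simp only [boxInterior, Set.mem_ofPred_eq]; push_cast; omega
  · simp only [boxInterior, Set.mem_ofPred_eq]; push_cast; omega
  · rw [mem_cells] at hn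
    refine ⟨?_, Bool.rec ?_ ?_⟩ <;> simp only [boxInterior, forward, Set.mem_ofPred_eq] <;> omega
  · rw [mem_cells] at hn
    refine ⟨?_, Bool.rec ?_ ?_⟩ <;> simp only [boxInterior, forward, Set.mem_ofPred_eq] <;> omega

theorem boxEnergy_add_right_le (p : Site) (L A A' : ℕ) (c : Site × Bool → ℝ) :
    boxEnergy p L (A + A') c ≤ boxEnergy p L A c + boxEnergy (p.1, p.2 + A) L A' c := by
  refine minEnergy_union_le (fun n => ?_) (fun n => ?_) (fun n => ?_) (fun n hn => ?_)
    (fun n hn => ?_) c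
  · simp only [Finset.mem_union, mem_cells]; push_cast; omega
  · simp only [boxInterior, Set.mem_ofPred_eq]; push_cast; omega
  · simp only [boxInterior, Set.mem_ofPred_eq]; push_cast; omega
  · rw [mem_cells] at hn
    refine ⟨?_, Bool.rec ?_ ?_⟩ <;> simp only [boxInterior, forward, Set.mem_ofPred_eq] <;> omega
  · rw [mem_cells] at hn
    refine ⟨?_, Bool.rec ?_ ?_⟩ <;> simp only [boxInterior, forward, Set.mem_ofPred_eq] <;> omega

/-- The translation of links. -/
def translate (t : Site) (x : Site × Bool) : Site × Bool := (x.1 + t, x.2)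

theorem translate_injective (t : Site) : Function.Injective (translate t) := by
  rintro ⟨n, b⟩ ⟨m, d⟩ h
  simpa [translate] using h

theorem boxEnergy_translate_le (p t : Site) (L A : ℕ) (c : Site × Bool → ℝ) :
    boxEnergy (p + t) L A c ≤ boxEnergy p L A (c ∘ translate t) := by
  refine le_ciInf fun φ => ?_
  let ψ : Site → ℝ := fun n => φ.1 (n - t) + t.1
  have hψ : ∀ n, n ∉ boxInterior (p + t) L A → ψ n = n.1 := fun n hn => by
    have : n - t ∉ boxInterior p L A := fun h => hn (by
      simp only [boxInterior, Set.mem_ofPred_eq, Prod.fst_sub, Prod.snd_sub, Prod.fst_add,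
        Prod.snd_add] at h ⊢
      omega)
    simp [ψ, φ.2 _ this]
  refine (minEnergy_le c ⟨ψ, hψ⟩).trans_eq ?_
  refine (Finset.sum_bij (fun n _ => n + t) (fun n hn => ?_) (fun _ _ _ _ h => add_right_cancel h)
    (fun n hn => ⟨n - t, ?_, sub_add_cancel n t⟩) fun n _ => ?_).symm
  · simp only [mem_cells, Prod.fst_add, Prod.snd_add] at hn ⊢
    omega
  · simp only [mem_cells, Prod.fst_add, Prod.snd_add, Prod.fst_sub, Prod.snd_sub] at hn ⊢
    omega
  · have hf : ∀ b, forward (n + t) b - t = forward n b := by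
      rintro (_ | _) <;> ext <;> simp [forward] <;> ring
    simp [cellEnergy, ψ, hf, translate]

theorem boxEnergy_translate (p t : Site) (L A : ℕ) (c : Site × Bool → ℝ) :
    boxEnergy (p + t) L A c = boxEnergy p L A (c ∘ translate t) := by
  refine (boxEnergy_translate_le p t L A c).antisymm ?_
  have h := boxEnergy_translate_le (p + t) (-t) L A (c ∘ translate t)
  have e : (c ∘ translate t) ∘ translate (-t) = c := by
    ext ⟨n, b⟩
    simp [translate]
  rwa [e, add_neg_cancel_right] at h

/-- The link from a site to one of its forward neighbours. -/
def link (x : Site × Bool) : Sym2 Site := s(x.1, forward x.1 x.2)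

theorem adj_forward (n : Site) (b : Bool) : lattice.Adj n (forward n b) := by
  cases b <;> simp [lattice, forward]

theorem link_mem_edgeSet (x : Site × Bool) : link x ∈ lattice.edgeSet := adj_forward x.1 x.2

theorem link_injective : Function.Injective link := by
  rintro ⟨⟨x, y⟩, b⟩ ⟨⟨x', y'⟩, b'⟩ h
  cases b <;> cases b' <;>
    simp only [link, forward, Sym2.eq_iff, Prod.mk.injEq, and_true, reduceCtorEq, and_false] at h ⊢ <;>
    omega

theorem exists_link_eq {e : Sym2 Site} (he : e ∈ lattice.edgeSet) : ∃ x, link x = e := by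
  induction e using Sym2.ind with
  | _ n m =>
    obtain ⟨x, y⟩ := n
    obtain ⟨x', y'⟩ := m
    have h : |x - x'| + |y - y'| = 1 := he
    have h' : (x' = x + 1 ∧ y' = y) ∨ (x = x' + 1 ∧ y = y') ∨ (x' = x ∧ y' = y + 1) ∨
        (x = x' ∧ y = y' + 1) := by
      rcases abs_cases (x - x') with h1 | h1 <;> rcases abs_cases (y - y') with h2 | h2 <;> omega
    rcases h' with ⟨rfl, rfl⟩ | ⟨rfl, rfl⟩ | ⟨rfl, rfl⟩ | ⟨rfl, rfl⟩
    · exact ⟨((x, y'), false), rfl⟩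
    · exact ⟨((x', y), false), Sym2.eq_swap⟩
    · exact ⟨((x', y), true), rfl⟩
    · exact ⟨((x, y'), true), Sym2.eq_swap⟩

theorem mem_rectangle {L A : ℕ} {n : Site} :
    n ∈ rectangle L A ↔ (0 ≤ n.1 ∧ n.1 ≤ L) ∧ 0 ≤ n.2 ∧ n.2 < A := by
  simp [rectangle]

theorem link_mem_links {Λ : Finset Site} {x : Site × Bool} :
    link x ∈ links Λ ↔ x.1 ∈ Λ ∧ forward x.1 x.2 ∈ Λ := by
  rw [links, Finset.mem_filter, and_iff_left (link_mem_edgeSet x), link, Finset.mk_mem_sym2_iff]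

theorem sum_links_rectangle (L A : ℕ) (f : Sym2 Site → ℝ)
    (hf : ∀ n, n ∉ boxInterior 0 L A → forward n true ∉ boxInterior 0 L A → f (link (n, true)) = 0) :
    ∑ e ∈ links (rectangle L A), f e = ∑ n ∈ cells 0 L A, ∑ b, f (link (n, b)) := by
  classical
  rw [← Finset.sum_product (cells 0 L A) Finset.univ (fun x => f (link x)),
    ← Finset.sum_image (f := f) fun x _ y _ h => link_injective h]
  set T := (cells 0 L A ×ˢ Finset.univ).image link
  have hT : ∀ x, link x ∈ T ↔ x.1 ∈ cells 0 L A := fun x => by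
    simp only [T, Finset.mem_image, Finset.mem_product, Finset.mem_univ, and_true]
    exact ⟨fun ⟨y, hy, h⟩ => link_injective h ▸ hy, fun h => ⟨x, h, rfl⟩⟩
  have h1 : ∑ e ∈ links (rectangle L A), f e = ∑ e ∈ links (rectangle L A) ∪ T, f e := by
    refine Finset.sum_subset Finset.subset_union_left fun e he hne => ?_
    have heT := (Finset.mem_union.1 he).resolve_left hne
    obtain ⟨⟨n, b⟩, -, rfl⟩ := Finset.mem_image.1 heT
    rw [hT] at heT
    rw [link_mem_links, mem_rectangle, mem_rectangle] at hne
    rw [mem_cells] at heT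
    cases b
    · simp only [forward, Prod.fst_zero, Prod.snd_zero] at hne heT
      omega
    · simp only [forward, Prod.fst_zero, Prod.snd_zero] at hne heT
      apply hf <;> simp only [boxInterior, forward, Set.mem_ofPred_eq, Prod.fst_zero, Prod.snd_zero] <;>
        omega
  have h2 : ∑ e ∈ T, f e = ∑ e ∈ links (rectangle L A) ∪ T, f e := by
    refine Finset.sum_subset Finset.subset_union_right fun e he hne => ?_
    have hel := (Finset.mem_union.1 he).resolve_right hne
    obtain ⟨⟨n, b⟩, rfl⟩ := exists_link_eq (Finset.mem_filter.1 hel).2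
    rw [hT, mem_cells] at hne
    rw [link_mem_links, mem_rectangle, mem_rectangle] at hel
    cases b
    · simp only [forward, Prod.fst_zero, Prod.snd_zero] at hne hel
      omega
    · simp only [forward, Prod.fst_zero, Prod.snd_zero] at hne hel
      apply hf <;> simp only [boxInterior, forward, Set.mem_ofPred_eq, Prod.fst_zero, Prod.snd_zero] <;>
        omega
  rw [h1, h2]

theorem dissipationFunctional_smul (Λ : Finset Site) (c : Sym2 Site → ℝ) (φ : Site → ℝ) (r : ℝ) :
    dissipationFunctional Λ c (fun n => r * φ n) = r ^ 2 * dissipationFunctional Λ c φ := by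
  rw [dissipationFunctional, dissipationFunctional, Finset.mul_sum]
  refine Finset.sum_congr rfl fun e _ => ?_
  induction e using Sym2.ind with
  | _ n m => simp only [sqDrop, Sym2.lift_mk]; ring

theorem dissipationFunctional_congr {Λ : Finset Site} (c : Sym2 Site → ℝ) {φ ψ : Site → ℝ}
    (h : ∀ n ∈ Λ, φ n = ψ n) : dissipationFunctional Λ c φ = dissipationFunctional Λ c ψ := by
  refine Finset.sum_congr rfl fun e he => ?_
  induction e using Sym2.ind with
  | _ n m =>
    have he' := Finset.mk_mem_sym2_iff.1 (Finset.mem_filter.1 he).1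
    simp only [sqDrop, Sym2.lift_mk, h n he'.1, h m he'.2]

/-- Dirichlet's principle. -/
theorem dissipationFunctional_le {Λ : Finset Site} {S : Set Site} {c : Sym2 Site → ℝ}
    (hc : ∀ e ∈ links Λ, 0 ≤ c e) {Vbar V φ : Site → ℝ} (hV : IsPotential Λ S c Vbar V)
    (hφ : ∀ n ∈ S, φ n = Vbar n) :
    dissipationFunctional Λ c V ≤ dissipationFunctional Λ c φ := by
  have h0 : ∑ e ∈ links Λ, dropMul V (φ - V) e * c e = 0 := by
    rw [sum_links_dropMul]
    refine Finset.sum_eq_zero fun n hn => ?_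
    by_cases h : n ∈ S
    · simp [hφ n h, hV.fixed n h]
    · rw [hV.kirchhoff n hn h, zero_mul]
  have h1 : dissipationFunctional Λ c φ = dissipationFunctional Λ c V +
      2 * ∑ e ∈ links Λ, dropMul V (φ - V) e * c e + dissipationFunctional Λ c (φ - V) := by
    simp only [dissipationFunctional, Finset.mul_sum]
    rw [← Finset.sum_add_distrib, ← Finset.sum_add_distrib]
    refine Finset.sum_congr rfl fun e _ => ?_
    induction e using Sym2.ind with
    | _ a b => simp only [sqDrop, dropMul, Sym2.lift_mk, Pi.sub_apply]; ring
  have h2 : 0 ≤ dissipationFunctional Λ c (φ - V) := by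
    refine Finset.sum_nonneg fun e he => mul_nonneg ?_ (hc e he)
    induction e using Sym2.ind with
    | _ a b => exact sq_nonneg _
  linarith

theorem dissipationFunctional_rectangle {L A : ℕ} {c : Sym2 Site → ℝ}
    (hc : ∀ e ∈ lattice.edgeSet, 0 ≤ c e) (φ : Admissible (boxInterior 0 L A)) :
    dissipationFunctional (rectangle L A) c φ.1 =
      ∑ n ∈ cells 0 L A, cellEnergy (fun x => c (link x)) φ.1 n := by
  rw [dissipationFunctional, sum_links_rectangle L A (fun e => sqDrop φ.1 e * c e)]
  · refine Finset.sum_congr rfl fun n _ => Finset.sum_congr rfl fun b _ => ?_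
    rw [abs_of_nonneg (hc _ (link_mem_edgeSet _)), link, sqDrop, Sym2.lift_mk]
    ring
  · intro n h1 h2
    have h : φ.1 n - φ.1 (forward n true) = 0 := by
      rw [φ.2 _ h1, φ.2 _ h2, forward, sub_self]
    simp [link, sqDrop, h]

theorem notMem_boxInterior_of_mem_boundary {L A : ℕ} {n : Site}
    (hn : n ∈ boundary (rectangle L A)) : n ∉ boxInterior 0 L A := by
  obtain ⟨-, m, hm, hnm⟩ := hn
  have h : |n.1 - m.1| + |n.2 - m.2| = 1 := hnm
  rw [mem_rectangle] at hm
  simp only [boxInterior, Set.mem_ofPred_eq, Prod.fst_zero, Prod.snd_zero]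
  rcases abs_cases (n.1 - m.1) with h1 | h1 <;> rcases abs_cases (n.2 - m.2) with h2 | h2 <;> omega

theorem mem_boundary_of_notMem_boxInterior {L A : ℕ} {n : Site} (hn : n ∈ rectangle L A)
    (hI : n ∉ boxInterior 0 L A) : n ∈ boundary (rectangle L A) := by
  refine ⟨hn, ?_⟩
  rw [mem_rectangle] at hn
  simp only [boxInterior, Set.mem_ofPred_eq, Prod.fst_zero, Prod.snd_zero] at hI
  have h : n.1 = 0 ∨ n.1 = L ∨ n.2 = 0 ∨ n.2 + 1 = A := by omega
  rcases h with h | h | h | h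
  · exact ⟨(n.1 - 1, n.2), by rw [mem_rectangle]; dsimp only; omega, by simp [lattice]⟩
  · exact ⟨(n.1 + 1, n.2), by rw [mem_rectangle]; dsimp only; omega, by simp [lattice]⟩
  · exact ⟨(n.1, n.2 - 1), by rw [mem_rectangle]; dsimp only; omega, by simp [lattice]⟩
  · exact ⟨(n.1, n.2 + 1), by rw [mem_rectangle]; dsimp only; omega, by simp [lattice]⟩

theorem closedDissipation_eq {v₀ : ℝ} (hv : 0 < v₀) (L A : ℕ) {c : Sym2 Site → ℝ}
    (hc : ∀ e ∈ lattice.edgeSet, 0 ≤ c e) :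
    closedDissipation v₀ L A c = v₀ ^ 2 * boxEnergy 0 L A fun x => c (link x) := by
  classical
  have hc' : ∀ e ∈ links (rectangle L A), 0 ≤ c e := fun e he => hc e (Finset.mem_filter.1 he).2
  obtain ⟨V, hV⟩ := exists_isPotential (rectangle L A) (boundary (rectangle L A)) c hc'
    (fun n => (n.1 : ℝ) * v₀)
  rw [closedDissipation, dissipation_eq _ _ _ hc' _ V hV]
  apply le_antisymm
  · rw [boxEnergy, minEnergy, Real.mul_iInf_of_nonneg (sq_nonneg v₀)]
    refine le_ciInf fun φ => ?_
    rw [← dissipationFunctional_rectangle hc φ, ← dissipationFunctional_smul]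
    refine dissipationFunctional_le hc' hV fun n hn => ?_
    rw [φ.2 n (notMem_boxInterior_of_mem_boundary hn), mul_comm]
  · let φ : Site → ℝ := fun n => if n ∈ rectangle L A then V n / v₀ else n.1
    have hφ : ∀ n, n ∉ boxInterior 0 L A → φ n = n.1 := fun n hn => by
      by_cases h : n ∈ rectangle L A
      · simp only [φ, h, if_true, hV.fixed n (mem_boundary_of_notMem_boxInterior h hn)]
        exact mul_div_cancel_right₀ _ hv.ne'
      · simp [φ, h]
    have h1 : dissipationFunctional (rectangle L A) c V =
        v₀ ^ 2 * dissipationFunctional (rectangle L A) c φ := by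
      rw [← dissipationFunctional_smul]
      refine dissipationFunctional_congr c fun n hn => ?_
      simp only [φ, hn, if_true]
      field_simp
    rw [h1, dissipationFunctional_rectangle hc ⟨φ, hφ⟩]
    exact mul_le_mul_of_nonneg_left (minEnergy_le _ _) (sq_nonneg v₀)

/-! ### Deterministic limits of double sequences -/

theorem tendsto_inner_limits {ι κ : Type*} {l : Filter ι} {l' : Filter κ} [l.NeBot]
    {F : ι → κ → ℝ} {c : ℝ} (hF : Tendsto (fun p : ι × κ => F p.1 p.2) (l ×ˢ l') (𝓝 c))
    {g : κ → ℝ} (hg : ∀ᶠ k in l', Tendsto (fun i => F i k) l (𝓝 (g k))) : Tendsto g l' (𝓝 c) := by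
  rw [(closed_nhds_basis c).tendsto_right_iff]
  rintro s ⟨hs, hsc⟩
  have h := (eventually_prod_iff.1 (hF.eventually_mem hs))
  obtain ⟨p, hp, q, hq, hpq⟩ := h
  filter_upwards [hq, hg] with k hk hgk
  exact hsc.mem_of_tendsto hgk (hp.mono fun i hi => hpq hi hk)

theorem div_le_of_subadditive {e : ℕ → ℕ → ℝ} {m : ℝ} (h0 : ∀ L A, 0 ≤ e L A)
    (h1 : ∀ A, Subadditive fun L => e L A) (h2 : ∀ L, Subadditive (e L))
    (hm : ∀ L A, e L A ≤ L * A * m) (hm0 : 0 ≤ m) {L₀ A₀ L A : ℕ} (hL₀ : 0 < L₀) (hA₀ : 0 < A₀)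
    (hL : 0 < L) (hA : 0 < A) :
    e L A / (L * A) ≤ e L₀ A₀ / (L₀ * A₀) + m * (A₀ / A + L₀ / L) := by
  have a1 := (h1 A).apply_mul_add_le (L / L₀) L₀ (L % L₀)
  have a2 := (h2 L₀).apply_mul_add_le (A / A₀) A₀ (A % A₀)
  rw [Nat.div_add_mod' L L₀] at a1
  rw [Nat.div_add_mod' A A₀] at a2
  have b1 := hm (L % L₀) A
  have b2 := hm L₀ (A % A₀)
  have hq : ((L / L₀ : ℕ) : ℝ) * L₀ ≤ L := by exact_mod_cast Nat.div_mul_le_self L L₀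
  have hp : ((A / A₀ : ℕ) : ℝ) * A₀ ≤ A := by exact_mod_cast Nat.div_mul_le_self A A₀
  have hr : ((L % L₀ : ℕ) : ℝ) ≤ L₀ := by exact_mod_cast (Nat.mod_lt L hL₀).le
  have hs : ((A % A₀ : ℕ) : ℝ) ≤ A₀ := by exact_mod_cast (Nat.mod_lt A hA₀).le
  have hL₀' : (0 : ℝ) < L₀ := by exact_mod_cast hL₀
  have hA₀' : (0 : ℝ) < A₀ := by exact_mod_cast hA₀
  have hL' : (0 : ℝ) < L := by exact_mod_cast hL
  have hA' : (0 : ℝ) < A := by exact_mod_cast hA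
  have hq0 : 0 ≤ ((L / L₀ : ℕ) : ℝ) := Nat.cast_nonneg _
  have hp0 : 0 ≤ ((A / A₀ : ℕ) : ℝ) := Nat.cast_nonneg _
  generalize ((L / L₀ : ℕ) : ℝ) = q at *
  generalize ((A / A₀ : ℕ) : ℝ) = p at *
  have he0 := h0 L₀ A₀
  have c1 : e (L % L₀) A ≤ L₀ * A * m := b1.trans (by gcongr)
  have c2 : q * e L₀ (A % A₀) ≤ L * A₀ * m := by
    calc q * e L₀ (A % A₀) ≤ q * (L₀ * A₀ * m) :=
          mul_le_mul_of_nonneg_left (b2.trans (by gcongr)) hq0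
      _ = q * L₀ * A₀ * m := by ring
      _ ≤ _ := by gcongr
  have c3 : q * (p * e L₀ A₀) ≤ L * A * (e L₀ A₀ / (L₀ * A₀)) := by
    calc q * (p * e L₀ A₀) = (q * L₀) * (p * A₀) * (e L₀ A₀ / (L₀ * A₀)) := by field_simp
      _ ≤ _ := by gcongr
  have c4 : q * e L₀ A ≤ q * (p * e L₀ A₀ + e L₀ (A % A₀)) :=
    mul_le_mul_of_nonneg_left a2 hq0
  have c5 : L * A * (e L₀ A₀ / (L₀ * A₀) + m * (A₀ / A + L₀ / L)) =
      L * A * (e L₀ A₀ / (L₀ * A₀)) + L * A₀ * m + L₀ * A * m := by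
    field_simp
    ring
  rw [div_le_iff₀' (by positivity), c5]
  linarith

theorem exists_tendsto_of_subadditive {e : ℕ → ℕ → ℝ} {m : ℝ} (h0 : ∀ L A, 0 ≤ e L A)
    (h1 : ∀ A, Subadditive fun L => e L A) (h2 : ∀ L, Subadditive (e L))
    (hm : ∀ L A, e L A ≤ L * A * m) (hm0 : 0 ≤ m) :
    ∃ c : ℝ, Tendsto (fun p : ℕ × ℕ => e p.1 p.2 / ((p.1 : ℝ) * (p.2 : ℝ))) (atTop ×ˢ atTop)
      (𝓝 c) := by
  let S : Set ℝ := {x | ∃ L A : ℕ, 0 < L ∧ 0 < A ∧ e L A / ((L : ℝ) * A) = x}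
  have hS : BddBelow S := ⟨0, by
    rintro _ ⟨L, A, -, -, rfl⟩
    exact div_nonneg (h0 L A) (by positivity)⟩
  have hne : S.Nonempty := ⟨_, 1, 1, one_pos, one_pos, rfl⟩
  have hpos : ∀ᶠ p : ℕ × ℕ in atTop ×ˢ atTop, 0 < p.1 ∧ 0 < p.2 :=
    (eventually_gt_atTop 0).prod_mk (eventually_gt_atTop 0)
  refine ⟨sInf S, tendsto_order.2 ⟨fun a ha => ?_, fun a ha => ?_⟩⟩
  · filter_upwards [hpos] with p hp
    exact ha.trans_le (csInf_le hS ⟨p.1, p.2, hp.1, hp.2, rfl⟩)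
  · obtain ⟨_, ⟨L₀, A₀, hL₀, hA₀, rfl⟩, hlt⟩ := exists_lt_of_csInf_lt hne ha
    have hlim : Tendsto (fun p : ℕ × ℕ => e L₀ A₀ / ((L₀ : ℝ) * A₀) +
        m * ((A₀ : ℝ) / (p.2 : ℝ) + (L₀ : ℝ) / (p.1 : ℝ))) (atTop ×ˢ atTop)
        (𝓝 (e L₀ A₀ / ((L₀ : ℝ) * A₀) + m * (0 + 0))) :=
      tendsto_const_nhds.add ((((tendsto_const_div_atTop_nhds_zero_nat (A₀ : ℝ)).comp
        tendsto_snd).add ((tendsto_const_div_atTop_nhds_zero_nat (L₀ : ℝ)).comp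
        tendsto_fst)).const_mul m)
    rw [add_zero, mul_zero, add_zero] at hlim
    filter_upwards [hlim.eventually_lt_const hlt, hpos] with p hp hp0
    exact (div_le_of_subadditive h0 h1 h2 hm hm0 hL₀ hA₀ hp0.1 hp0.2).trans_lt hp

/-! ### The energy of boxes in a field of independent conductances -/

/-- A field of independent, identically distributed and integrable random variables, indexed by
the links of the lattice. -/
structure IsIIDField {Ω : Type*} [MeasurableSpace Ω] (P : Measure Ω)
    (Y : Site × Bool → Ω → ℝ) : Prop where
  measurable : ∀ x, Measurable (Y x)
  indep : iIndepFun Y P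
  identDistrib : ∀ x y, IdentDistrib (Y x) (Y y) P P
  integrable : ∀ x, Integrable (Y x) P

theorem measurable_boxEnergy (p : Site) (L A : ℕ) : Measurable (boxEnergy p L A) :=
  measurable_minEnergy _ _

theorem eq_of_mem_blocks {i j N : ℕ} {x : ℤ} (hi : (i : ℤ) * N ≤ x ∧ x < i * N + N)
    (hj : (j : ℤ) * N ≤ x ∧ x < j * N + N) : i = j := by
  have h : ∀ {i j : ℕ}, x < i * N + N → (j : ℤ) * N ≤ x → j ≤ i := fun {i j} h1 h2 => by
    by_contra! hij
    have h3 : ((i : ℤ) + 1) * N ≤ j * N :=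
      mul_le_mul_of_nonneg_right (by exact_mod_cast hij) (Int.natCast_nonneg N)
    linarith
  exact le_antisymm (h hj.2 hi.1) (h hi.2 hj.1)

namespace IsIIDField

variable {Ω : Type*} [MeasurableSpace Ω] {P : Measure Ω} {Y : Site × Bool → Ω → ℝ}

theorem measurable_field (hY : IsIIDField P Y) : Measurable fun ω x => Y x ω :=
  measurable_pi_lambda _ hY.measurable

theorem measurable_energy (hY : IsIIDField P Y) (p : Site) (L A : ℕ) :
    Measurable fun ω => boxEnergy p L A fun x => Y x ω :=
  (measurable_boxEnergy p L A).comp hY.measurable_field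

theorem identDistrib_translate (hY : IsIIDField P Y) (t : Site) :
    IdentDistrib (fun ω x => Y (translate t x) ω) (fun ω x => Y x ω) P P where
  aemeasurable_fst := (measurable_pi_lambda _ fun x => hY.measurable (translate t x)).aemeasurable
  aemeasurable_snd := hY.measurable_field.aemeasurable
  map_eq := by
    rw [hY.indep.map_fun_eq_infinitePi_map hY.measurable,
      (hY.indep.precomp (translate_injective t)).map_fun_eq_infinitePi_map
        fun x => hY.measurable (translate t x)]
    congr 1 with x : 1
    exact (hY.identDistrib _ _).map_eq

theorem indepFun_energy (hY : IsIIDField P Y) {p p' : Site} {L L' A A' : ℕ}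
    (h : Disjoint (cells p L A) (cells p' L' A')) :
    IndepFun (fun ω => boxEnergy p L A fun x => Y x ω)
      (fun ω => boxEnergy p' L' A' fun x => Y x ω) P := by
  classical
  let S : Site → ℕ → ℕ → Finset (Site × Bool) := fun p L A => cells p L A ×ˢ Finset.univ
  let G : ∀ (p : Site) (L A : ℕ), (S p L A → ℝ) → ℝ := fun p L A z =>
    boxEnergy p L A fun x => if hx : x ∈ S p L A then z ⟨x, hx⟩ else 0
  have hG : ∀ p L A, Measurable (G p L A) := fun p L A => by
    refine (measurable_boxEnergy p L A).comp (measurable_pi_lambda _ fun x => ?_)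
    by_cases hx : x ∈ S p L A
    · simpa [hx] using measurable_pi_apply _
    · simp [hx]
  have hGY : ∀ p L A, (fun ω => boxEnergy p L A fun x => Y x ω) =
      G p L A ∘ fun ω (i : S p L A) => Y i ω := fun p L A => by
    funext ω
    refine minEnergy_congr _ fun n hn b => ?_
    have : (n, b) ∈ S p L A := by simp [S, hn]
    simp [this]
  rw [hGY p L A, hGY p' L' A']
  exact (hY.indep.indepFun_finset (S p L A) (S p' L' A')
    (Finset.disjoint_product.2 (Or.inl h)) hY.measurable).comp (hG _ _ _) (hG _ _ _)

theorem integrable_energy (hY : IsIIDField P Y) (p : Site) (L A : ℕ) :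
    Integrable (fun ω => boxEnergy p L A fun x => Y x ω) P := by
  refine Integrable.mono' (integrable_finsetSum (cells p L A)
    fun n _ => (hY.integrable (n, false)).abs)
    (hY.measurable_energy p L A).aestronglyMeasurable (ae_of_all _ fun ω => ?_)
  rw [boxEnergy, Real.norm_of_nonneg (minEnergy_nonneg _ _ _)]
  exact minEnergy_le_sum _ _ _

theorem integral_energy_le (hY : IsIIDField P Y) (L A : ℕ) :
    ∫ ω, boxEnergy 0 L A (fun x => Y x ω) ∂P ≤ L * A * ∫ ω, |Y (0, false) ω| ∂P := by
  refine (integral_mono (hY.integrable_energy 0 L A) (integrable_finsetSum (cells 0 L A)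
    fun n _ => (hY.integrable (n, false)).abs) fun ω => minEnergy_le_sum _ _ _).trans_eq ?_
  rw [integral_finsetSum _ fun n _ => (hY.integrable (n, false)).abs]
  have h : ∀ n, ∫ ω, |Y (n, false) ω| ∂P = ∫ ω, |Y (0, false) ω| ∂P := fun n =>
    ((hY.identDistrib (n, false) (0, false)).comp measurable_norm).integral_eq
  simp [h, card_cells]

theorem isSubadditiveProcess_right (hY : IsIIDField P Y) (A : ℕ) :
    IsSubadditiveProcess P fun k n ω => boxEnergy ((k : ℤ), 0) n A fun x => Y x ω where
  measurable k n := hY.measurable_energy _ n A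
  nonneg k n ω := minEnergy_nonneg _ _ _
  zero k ω := by simp [boxEnergy, cells, minEnergy_empty]
  subadd k m n ω := by simpa using boxEnergy_add_left_le ((k : ℤ), 0) m n A fun x => Y x ω
  identDistrib k := by
    have h := (hY.identDistrib_translate ((k : ℤ), 0)).comp (u := fun c (n : ℕ) => boxEnergy 0 n A c)
      (measurable_pi_lambda _ fun n => measurable_boxEnergy 0 n A)
    refine (congrArg (IdentDistrib · _ P P) (funext₂ fun ω n => ?_)).mpr h
    simpa [Function.comp_def] using boxEnergy_translate 0 ((k : ℤ), 0) n A fun x => Y x ω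
  indep N i j hij := by
    refine hY.indepFun_energy (Finset.disjoint_left.2 fun n h1 h2 => hij ?_)
    rw [mem_cells] at h1 h2
    exact eq_of_mem_blocks (x := n.1) (by simpa using h1.1) (by simpa using h2.1)
  integrable := hY.integrable_energy _ 1 A

theorem isSubadditiveProcess_up (hY : IsIIDField P Y) (L : ℕ) :
    IsSubadditiveProcess P fun k n ω => boxEnergy (0, (k : ℤ)) L n fun x => Y x ω where
  measurable k n := hY.measurable_energy _ L n
  nonneg k n ω := minEnergy_nonneg _ _ _
  zero k ω := by simp [boxEnergy, cells, minEnergy_empty]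
  subadd k m n ω := by simpa using boxEnergy_add_right_le (0, (k : ℤ)) L m n fun x => Y x ω
  identDistrib k := by
    have h := (hY.identDistrib_translate (0, (k : ℤ))).comp (u := fun c (n : ℕ) => boxEnergy 0 L n c)
      (measurable_pi_lambda _ fun n => measurable_boxEnergy 0 L n)
    refine (congrArg (IdentDistrib · _ P P) (funext₂ fun ω n => ?_)).mpr h
    simpa [Function.comp_def] using boxEnergy_translate 0 (0, (k : ℤ)) L n fun x => Y x ω
  indep N i j hij := by
    refine hY.indepFun_energy (Finset.disjoint_left.2 fun n h1 h2 => hij ?_)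
    rw [mem_cells] at h1 h2
    exact eq_of_mem_blocks (x := n.2) (by simpa using h1.2) (by simpa using h2.2)
  integrable := hY.integrable_energy _ L 1

theorem exists_limits [IsProbabilityMeasure P] (hY : IsIIDField P Y) :
    ∃ cbar : ℝ, ∃ g h : ℕ → ℝ,
      Tendsto (fun p : ℕ × ℕ => (∫ ω, boxEnergy 0 p.1 p.2 (fun x => Y x ω) ∂P) /
        ((p.1 : ℝ) * (p.2 : ℝ))) (atTop ×ˢ atTop) (𝓝 cbar) ∧
      (∀ A, Tendsto (fun L : ℕ => (∫ ω, boxEnergy 0 L A (fun x => Y x ω) ∂P) /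
        ((L : ℝ) * (A : ℝ))) atTop (𝓝 (g A))) ∧
      (∀ L, Tendsto (fun A : ℕ => (∫ ω, boxEnergy 0 L A (fun x => Y x ω) ∂P) /
        ((L : ℝ) * (A : ℝ))) atTop (𝓝 (h L))) ∧
      ∀ᵐ ω ∂P, (∀ A, Tendsto (fun L : ℕ => boxEnergy 0 L A (fun x => Y x ω) /
        ((L : ℝ) * (A : ℝ))) atTop (𝓝 (g A))) ∧
      (∀ L, Tendsto (fun A : ℕ => boxEnergy 0 L A (fun x => Y x ω) /
        ((L : ℝ) * (A : ℝ))) atTop (𝓝 (h L))) := by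
  have hr := hY.isSubadditiveProcess_right
  have hu := hY.isSubadditiveProcess_up
  obtain ⟨cbar, hc⟩ := exists_tendsto_of_subadditive
    (e := fun L A => ∫ ω, boxEnergy 0 L A (fun x => Y x ω) ∂P)
    (fun L A => integral_nonneg fun ω => minEnergy_nonneg _ _ _) (fun A => (hr A).subadditive)
    (fun L => (hu L).subadditive) hY.integral_energy_le (integral_nonneg fun ω => abs_nonneg _)
  refine ⟨cbar, fun A => (hr A).subadditive.lim / A, fun L => (hu L).subadditive.lim / L, hc,
    fun A => ?_, fun L => ?_, ?_⟩
  · simpa only [div_div, Nat.cast_zero, Prod.mk_zero_zero] using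
      ((hr A).subadditive.tendsto_lim (hr A).bddBelow).div_const (A : ℝ)
  · simpa only [div_div, Nat.cast_zero, Prod.mk_zero_zero, mul_comm] using
      ((hu L).subadditive.tendsto_lim (hu L).bddBelow).div_const (L : ℝ)
  · filter_upwards [ae_all_iff.2 fun A => (hr A).ae_tendsto, ae_all_iff.2 fun L => (hu L).ae_tendsto]
      with ω h1 h2
    refine ⟨fun A => ?_, fun L => ?_⟩
    · simpa only [div_div, Nat.cast_zero, Prod.mk_zero_zero] using (h1 A).div_const (A : ℝ)
    · simpa only [div_div, Nat.cast_zero, Prod.mk_zero_zero, mul_comm] using (h2 L).div_const (L : ℝ)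

end IsIIDField

theorem isIIDField_link {Ω : Type*} [MeasurableSpace Ω] {P : Measure Ω}
    {C : Sym2 Site → Ω → ℝ}
    (hmeas : ∀ e ∈ lattice.edgeSet, Measurable (C e))
    (hindep : iIndepFun (fun (e : lattice.edgeSet) => C e) P)
    (hident : ∀ e ∈ lattice.edgeSet, ∀ e' ∈ lattice.edgeSet, IdentDistrib (C e) (C e') P P)
    (hmean : ∀ e ∈ lattice.edgeSet, Integrable (C e) P) :
    IsIIDField P fun x => C (link x) where
  measurable x := hmeas _ (link_mem_edgeSet x)
  indep := hindep.precomp (g := fun x => ⟨link x, link_mem_edgeSet x⟩) fun _ _ h =>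
    link_injective (congrArg Subtype.val h)
  identDistrib x y := hident _ (link_mem_edgeSet x) _ (link_mem_edgeSet y)
  integrable x := hmean _ (link_mem_edgeSet x)

end ResistorNetwork

theorem mainTheorem1 {Ω : Type*} [MeasurableSpace Ω] (P : Measure Ω) [IsProbabilityMeasure P]
    (C : Sym2 ResistorNetwork.Site → Ω → ℝ)
    (hmeas : ∀ e ∈ ResistorNetwork.lattice.edgeSet, Measurable (C e))
    (hnonneg : ∀ e ∈ ResistorNetwork.lattice.edgeSet, ∀ᵐ ω ∂P, 0 ≤ C e ω)
    (hindep : iIndepFun (fun (e : ResistorNetwork.lattice.edgeSet) => C e) P)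
    (hident : ∀ e ∈ ResistorNetwork.lattice.edgeSet, ∀ e' ∈ ResistorNetwork.lattice.edgeSet,
      IdentDistrib (C e) (C e') P P)
    (hmean : ∀ e ∈ ResistorNetwork.lattice.edgeSet, Integrable (C e) P) :
    ∃ cbar : ℝ, ∀ v₀ : ℝ, 0 < v₀ →
      (∀ L A : ℕ,
        Integrable (fun ω => ResistorNetwork.closedDissipation v₀ L A (fun e => C e ω)) P) ∧
      Tendsto (fun p : ℕ × ℕ =>
          (∫ ω, ResistorNetwork.closedDissipation v₀ p.1 p.2 (fun e => C e ω) ∂P) /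
            ((p.1 : ℝ) * (p.2 : ℝ)))
        (atTop ×ˢ atTop) (𝓝 (v₀ ^ 2 * cbar)) ∧
      ResistorNetwork.HasIteratedLimits (fun L A =>
          (∫ ω, ResistorNetwork.closedDissipation v₀ L A (fun e => C e ω) ∂P) /
            ((L : ℝ) * (A : ℝ)))
        (v₀ ^ 2 * cbar) ∧
      ∀ᵐ ω ∂P, ResistorNetwork.HasIteratedLimits (fun L A =>
          ResistorNetwork.closedDissipation v₀ L A (fun e => C e ω) / ((L : ℝ) * (A : ℝ)))
        (v₀ ^ 2 * cbar) := by
  obtain ⟨cbar, g, h, hc, hg, hh, has⟩ :=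
    (ResistorNetwork.isIIDField_link hmeas hindep hident hmean).exists_limits
  refine ⟨cbar, fun v₀ hv => ?_⟩
  have hpos : ∀ᵐ ω ∂P, ∀ e ∈ ResistorNetwork.lattice.edgeSet, 0 ≤ C e ω :=
    (ae_ball_iff (Set.to_countable _)).2 hnonneg
  have hW : ∀ᵐ ω ∂P, ∀ L A, ResistorNetwork.closedDissipation v₀ L A (fun e => C e ω) =
      v₀ ^ 2 * ResistorNetwork.boxEnergy 0 L A fun x => C (ResistorNetwork.link x) ω :=
    hpos.mono fun ω hω L A => ResistorNetwork.closedDissipation_eq hv L A hω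
  have hE : ∀ L A, ∫ ω, ResistorNetwork.closedDissipation v₀ L A (fun e => C e ω) ∂P =
      v₀ ^ 2 * ∫ ω, ResistorNetwork.boxEnergy 0 L A
        (fun x => C (ResistorNetwork.link x) ω) ∂P := fun L A => by
    rw [← integral_const_mul]
    exact integral_congr_ae (hW.mono fun ω hω => hω L A)
  have hT : Tendsto (fun p : ℕ × ℕ =>
      (∫ ω, ResistorNetwork.closedDissipation v₀ p.1 p.2 (fun e => C e ω) ∂P) /
        ((p.1 : ℝ) * (p.2 : ℝ))) (atTop ×ˢ atTop) (𝓝 (v₀ ^ 2 * cbar)) := by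
    simpa only [hE, mul_div_assoc] using hc.const_mul (v₀ ^ 2)
  have hg' : Tendsto g atTop (𝓝 cbar) :=
    ResistorNetwork.tendsto_inner_limits hc (Eventually.of_forall hg)
  have hh' : Tendsto h atTop (𝓝 cbar) :=
    ResistorNetwork.tendsto_inner_limits (hc.comp tendsto_prod_swap) (Eventually.of_forall hh)
  refine ⟨fun L A => ?_, hT, ?_, ?_⟩
  · refine (((ResistorNetwork.isIIDField_link hmeas hindep hident hmean).integrable_energy
      0 L A).const_mul (v₀ ^ 2)).congr (hW.mono fun ω hω => (hω L A).symm)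
  · simp only [hE, mul_div_assoc]
    exact ⟨⟨_, fun A _ => (hg A).const_mul (v₀ ^ 2), hg'.const_mul (v₀ ^ 2)⟩,
      _, fun L _ => (hh L).const_mul (v₀ ^ 2), hh'.const_mul (v₀ ^ 2)⟩
  · filter_upwards [hW, has] with ω hω ⟨h1, h2⟩
    simp only [hω, mul_div_assoc]
    exact ⟨⟨_, fun A _ => (h1 A).const_mul (v₀ ^ 2), hg'.const_mul (v₀ ^ 2)⟩,
      _, fun L _ => (h2 L).const_mul (v₀ ^ 2), hh'.const_mul (v₀ ^ 2)⟩
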